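/- Let $H$ be a real Hilbert space and let $a,b$ be bounded symmetric bilinear forms on $H$ with $b(v,v)\ge 0$ for all $v$ and $$\inf_{0\ne v\in H}\ \sup_{0\ne w\in H}\frac{a(v,w)}{\|v\|\,\|w\|}\ \ge\ C>0 .$$ Let $T:H\to H$ be the operator defined by $a(Tw,v)=b(w,v)$ for all $v\in H$, and assume that $T$ is compact. For a closed subspace $G\subset H$ that is stable with constant $C'>0$, i.e. $$\inf_{0\ne v\in G}\ \sup_{0\ne w\in G}\frac{a(v,w)}{\|v\|\,\|w\|}\ \ge\ C' ,$$ let $P_G:H\to G$ be the projection defined by $a(P_Gw,v)=a(w,v)$ for all $v\in G$. For subspaces $M,G$ put $\delta(M,G)=\sup_{x\in M,\|x\|=1}\operatorname{dist}(x,G)$. Algorithm. Let $G_0\subset G_1\subset\dots\subset G_N\subset H$ be closed subspaces, $k$ a natural number and $\widetilde G_0=G_0$. For $i=1,\dots,N$: (1) compute linearly independent, mutually $a$-orthogonal eigenvectors $\tilde u_1^{i-1},\dots,\tilde u_k^{i-1}\in\widetilde G_{i-1}$ belonging to the first $k$ eigenvalues $\tilde\mu_j^{i-1}\neq 0$ (the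 $k$ eigenvalues of largest modulus, counted with multiplicity) of the problem $\tilde\mu\, a(\tilde u,v)=b(\tilde u,v)$ for all $v\in\widetilde G_{i-1}$; (2) compute $\hat u_j^i\in G_i$ with $a(\hat u_j^i,v)=\frac{1}{\tilde\mu_j^{i-1}}\,b(\tilde u_j^{i-1},v)$ for all $v\in G_i$, $j=1,\dots,k$; (3) set $\widetilde G_i=G_0+\operatorname{span}\{\hat u_1^i,\dots,\hat u_k^i\}$. Finally, compute first $k$ eigenpairs on $\widetilde G_N$ as in (1) (there the eigenvalues may vanish). Theorem. Let $\mu\ne0$ be an eigenvalue of $T$, with eigenspace $M(\mu)=\ker(T-\mu)$, and let $C'>0$. There exist constants $\beta_1,\beta_2,\varepsilon>0$, depending only on $H,a,b,\mu$ and $C'$, such that the following holds. Let $k$ be at least the number, counted with multiplicity, of the eigenvalues of $T$ of modulus at least $|\mu|$, let $N\ge0$, and consider any execution of the algorithm in which $G_0,\dots,G_N$ and the auxiliary spaces $\widetilde G_0,\dots,\widetilde G_{N-1}$ are stable with constant $C'$. If $G_0$ is large enough, in the sense that $\|T-P_0T\|<\varepsilon$, where $P_0=P_{G_0}$, then $$\delta(M(\mu),\widetilde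 G_N)\ \le\ \beta_1\sum_{l=0}^{N}\bigl(\beta_2\,\|T-TP_0\|\bigr)^{N-l}\,\delta(M(\mu),G_l).$$ -/

import Mathlib

namespace MultilevelEigen

variable {H : Type*} [NormedAddCommGroup H] [InnerProductSpace ℝ H]

/-- The inf-sup condition on a subspace `G` with constant `C`:
`inf_{v ∈ G} sup_{w ∈ G} a(v,w) / (‖v‖ ‖w‖) ≥ C`. The supremum over `w` is the norm of the
functional `a(v, ·)` restricted to `G`. -/
def InfSup (a : H →L[ℝ] H →L[ℝ] ℝ) (G : Submodule ℝ H) (C : ℝ) : Prop :=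
  ∀ v ∈ G, C * ‖v‖ ≤ ‖(a v).comp G.subtypeL‖

/-- `S` maps `H` into `G` and `a(S w, v) = c(w, v)` for all `w ∈ H`, `v ∈ G`. -/
def IsGalerkinOp (a c : H →L[ℝ] H →L[ℝ] ℝ) (G : Submodule ℝ H) (S : H →L[ℝ] H) : Prop :=
  ∀ w, S w ∈ G ∧ ∀ v ∈ G, a (S w) v = c w v

open Classical in
/-- The operator `S : H → G` defined by `a(S w, v) = c(w, v)` for all `v ∈ G`
(see `galerkinOp_spec` and `galerkinOp_unique`). -/
noncomputable def galerkinOp (a c : H →L[ℝ] H →L[ℝ] ℝ) (G : Submodule ℝ H) : H →L[ℝ] H :=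
  if h : ∃ S, IsGalerkinOp a c G S then h.choose else 0

/-- The operator `T` on `H` with `a(T w, v) = b(w, v)` for all `v ∈ H`. -/
noncomputable def solutionOp (a b : H →L[ℝ] H →L[ℝ] ℝ) : H →L[ℝ] H := galerkinOp a b ⊤

/-- The `a`-projection `P_G` onto `G`: `a(P_G w, v) = a(w, v)` for all `v ∈ G`. -/
noncomputable def ritzProj (a : H →L[ℝ] H →L[ℝ] ℝ) (G : Submodule ℝ H) : H →L[ℝ] H :=
  galerkinOp a a G

theorem exists_isGalerkinOp [CompleteSpace H] (a c : H →L[ℝ] H →L[ℝ] ℝ)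
    (hsymm : ∀ v w, a v w = a w v) (G : Submodule ℝ H) (hG : IsClosed (G : Set H))
    {C : ℝ} (hC : 0 < C) (h : InfSup a G C) : ∃ S, IsGalerkinOp a c G S := by
  have : CompleteSpace G := hG.completeSpace_coe
  let R : (H →L[ℝ] ℝ) →L[ℝ] (G →L[ℝ] ℝ) := ContinuousLinearMap.precomp ℝ G.subtypeL
  let D : (G →L[ℝ] ℝ) →L[ℝ] G :=
    { toFun := fun f => (InnerProductSpace.toDual ℝ G).symm f
      map_add' := fun f g => map_add _ f g
      map_smul' := fun r f => by simp
      cont := (InnerProductSpace.toDual ℝ G).symm.continuous }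
  let L : (H →L[ℝ] H →L[ℝ] ℝ) → (H →L[ℝ] G) := fun e => D.comp (R.comp e)
  have hL : ∀ e x (y : G), inner ℝ (L e x) y = e x y := fun e x y => InnerProductSpace.toDual_symm_apply (x := y) (y := R (e x))
  let A : G →L[ℝ] G := (L a).comp G.subtypeL
  have hA : ∀ x y : G, inner ℝ (A x) y = a x y := fun x y => hL a x y
  have hb : ∀ x : G, C * ‖x‖ ≤ ‖A x‖ := fun x => by
    have : ‖A x‖ = ‖(a x).comp G.subtypeL‖ :=
      (InnerProductSpace.toDual ℝ G).symm.norm_map ((a x).comp G.subtypeL)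
    rw [this]; exact h x x.2
  have hanti : AntilipschitzWith (Real.toNNReal C⁻¹) A :=
    AddMonoidHomClass.antilipschitz_of_bound A fun x => by
      rw [Real.coe_toNNReal _ (inv_nonneg.2 hC.le), inv_mul_eq_div, le_div_iff₀ hC, mul_comm]
      exact hb x
  have hcl : IsClosed (LinearMap.range (A : G →ₗ[ℝ] G) : Set G) := by
    have h1 := hanti.isClosed_range A.uniformContinuous
    have h2 : (LinearMap.range (A : G →ₗ[ℝ] G) : Set G) = Set.range A := by ext; simp
    rw [h2]; exact h1
  have : CompleteSpace (LinearMap.range (A : G →ₗ[ℝ] G)) := hcl.completeSpace_coe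
  have htop : LinearMap.range (A : G →ₗ[ℝ] G) = ⊤ := by
    rw [← Submodule.orthogonal_eq_bot_iff, Submodule.eq_bot_iff]
    intro w hw
    have h0 : ∀ x : G, inner ℝ (A x) w = 0 := fun x =>
      (Submodule.mem_orthogonal _ w).1 hw (A x) ⟨x, rfl⟩
    have h1 : A w = 0 := by
      refine ext_inner_right ℝ fun x => ?_
      rw [hA, hsymm, ← hA, h0, inner_zero_left]
    have h2 := hb w
    rw [h1, norm_zero] at h2
    exact norm_le_zero_iff.1 (nonpos_of_mul_nonpos_right h2 hC)
  let E : G ≃L[ℝ] G := ContinuousLinearEquiv.ofBijective A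
    (LinearMap.ker_eq_bot.2 hanti.injective) htop
  refine ⟨G.subtypeL.comp ((E.symm : G →L[ℝ] G).comp (L c)), fun w => ⟨(E.symm (L c w)).2, ?_⟩⟩
  intro v hv
  have h1 : A (E.symm (L c w)) = L c w := E.apply_symm_apply _
  have h2 := hA (E.symm (L c w)) ⟨v, hv⟩
  rw [h1, hL] at h2
  exact h2.symm

theorem galerkinOp_spec [CompleteSpace H] (a c : H →L[ℝ] H →L[ℝ] ℝ)
    (hsymm : ∀ v w, a v w = a w v) (G : Submodule ℝ H) (hG : IsClosed (G : Set H))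
    {C : ℝ} (hC : 0 < C) (h : InfSup a G C) : IsGalerkinOp a c G (galerkinOp a c G) := by
  have hex := exists_isGalerkinOp a c hsymm G hG hC h
  rw [galerkinOp, dif_pos hex]
  exact hex.choose_spec

theorem galerkinOp_unique [CompleteSpace H] (a c : H →L[ℝ] H →L[ℝ] ℝ)
    (hsymm : ∀ v w, a v w = a w v) (G : Submodule ℝ H) (hG : IsClosed (G : Set H))
    {C : ℝ} (hC : 0 < C) (h : InfSup a G C) (S : H →L[ℝ] H) (hS : IsGalerkinOp a c G S) :
    S = galerkinOp a c G := by
  have hg := galerkinOp_spec a c hsymm G hG hC h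
  ext w
  have hmem := G.sub_mem (hS w).1 (hg w).1
  have h0 : (a (S w - galerkinOp a c G w)).comp G.subtypeL = 0 := by
    ext v
    simp [(hS w).2 v v.2, (hg w).2 v v.2]
  have h1 := h _ hmem
  have h2 : ‖(a (S w - galerkinOp a c G w)).comp G.subtypeL‖ = 0 :=
    (congrArg norm h0).trans ContinuousLinearMap.opNorm_zero
  rw [h2] at h1
  exact sub_eq_zero.1 (norm_le_zero_iff.1 (nonpos_of_mul_nonpos_right h1 hC))

/-- `δ(M, N) = sup_{x ∈ M, ‖x‖ = 1} dist(x, N)`. -/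
noncomputable def gap (M N : Submodule ℝ H) : ℝ :=
  sSup ((fun x => Metric.infDist x (N : Set H)) '' {x | x ∈ M ∧ ‖x‖ = 1})

/-- `(ν, u)` is an eigenpair on `G`: `0 ≠ u ∈ G` and `ν a(u, v) = b(u, v)` for all `v ∈ G`. -/
def IsEigenpair (a b : H →L[ℝ] H →L[ℝ] ℝ) (G : Submodule ℝ H) (ν : ℝ) (u : H) : Prop :=
  u ∈ G ∧ u ≠ 0 ∧ ∀ v ∈ G, ν * a u v = b u v

/-- The `(ν j, u j)`, `j = 1, …, k`, are first `k` eigenpairs on `G`, that is, belong to the `k`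
eigenvalues of largest modulus, counted with multiplicity, with mutually `a`-orthogonal `u j`:
any eigenvector not already accounted for by the `u j` has an eigenvalue whose modulus is at most
that of each `ν j`. -/
structure IsFirstEigenpairs (a b : H →L[ℝ] H →L[ℝ] ℝ) (G : Submodule ℝ H) {k : ℕ}
    (ν : Fin k → ℝ) (u : Fin k → H) : Prop where
  eigenpair : ∀ j, IsEigenpair a b G (ν j) (u j)
  linearIndependent : LinearIndependent ℝ u
  orthogonal : ∀ j l, j ≠ l → a (u j) (u l) = 0
  largest : ∀ (ν' : ℝ) (u' : H), IsEigenpair a b G ν' u' →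
    u' ∉ Submodule.span ℝ (Set.range u) → ∀ j, |ν'| ≤ |ν j|

/-- An execution of the multi-level algorithm for the first `k` eigenvalues on the levels
`G 0 ⊆ G 1 ⊆ ⋯ ⊆ G N`. It produces the auxiliary spaces `Gt i`, the eigenpairs
`(ν i j, u i j)` on `Gt i` and, for `i ≥ 1`, the solutions `uh i j ∈ G i` of the source problems.
Only the values at levels `i ≤ N` matter. -/
structure IsMultilevelRun (a b : H →L[ℝ] H →L[ℝ] ℝ) (k N : ℕ) (G Gt : ℕ → Submodule ℝ H)
    (ν : ℕ → Fin k → ℝ) (u uh : ℕ → Fin k → H) : Prop where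
  closed : ∀ i ≤ N, IsClosed (G i : Set H)
  nested : ∀ i < N, G i ≤ G (i + 1)
  start : Gt 0 = G 0
  /-- The eigenvalue problems on the auxiliary spaces (the last one, `i = N`, is the output). -/
  eigen : ∀ i ≤ N, IsFirstEigenpairs a b (Gt i) (ν i) (u i)
  /-- The next step divides by these eigenvalues. -/
  ne_zero : ∀ i < N, ∀ j, ν i j ≠ 0
  source : ∀ i < N, ∀ j, uh (i + 1) j ∈ G (i + 1) ∧
    ∀ v ∈ G (i + 1), a (uh (i + 1) j) v = 1 / ν i j * b (u i j) v
  enrich : ∀ i < N, Gt (i + 1) = G 0 ⊔ Submodule.span ℝ (Set.range (uh (i + 1)))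

end MultilevelEigen

namespace MultilevelEigen

/-! ### Compact symmetric operators: orthogonal eigenvector sums and bounds from eigenvalues -/

section Hilbert

variable {E : Type*} [NormedAddCommGroup E] [InnerProductSpace ℝ E]

/-! Although `a` may be indefinite, the eigenvalue problems become self-adjoint when moved to
another Hilbert space. Since `b` is positive semidefinite, `b(v, w) = ⟪S v, S w⟫` for some `S : H →
E`, and `T = Φ S` where `a(Φ y, v) = ⟪y, S v⟫`. On `E` the operator `K = S Φ` is symmetric and
compact and has the nonzero eigenvalues of `T`; for a stable `G` with projection `P`, the same holds
for `L = S P Φ` and `P T`. Moreover `(K - L)² = S (T - P T) (1 - P) Φ`, so smallness of `‖T - P T‖`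
forces `L` to be close to `K`.

Below `|μ|` the spectrum of `K` has a gap. A dimension count shows that `L`, off the span of its
first `k` eigenvectors, has no eigenvalue near `μ`, so `L - μ` is bounded below there. Lifted back
to `H`, this is `exists_norm_sub_le_residual`: every `x ∈ G` is within `c ‖P T x - μ x‖` of the span
of the first `k` discrete eigenvectors.

For one level (`gap_le_of_source`), let `w ∈ M(μ)` and let `e` be its projection error on the
auxiliary space. The residual of the projected `w` is the projection of `-T e`, and `T e = (T - T
P₀) e` because `P₀ e = 0`. The span of the computed eigenvectors thus contains `q` with `T w - T q`
of order `‖T - T P₀‖ δ(M(μ), G̃ᵢ)`. The source problems put the projection of `T q` on the next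
level into the next auxiliary space, which gives `dᵢ₊₁ ≤ β₁ δᵢ₊₁ + t dᵢ` with `t` proportional to
`‖T - T P₀‖`; iteration yields the sum. -/

theorem norm_sq_sum_of_orthogonal {ι : Type*} (s : Finset ι) (f : ι → E)
    (h : ∀ i ∈ s, ∀ j ∈ s, i ≠ j → inner ℝ (f i) (f j) = 0) :
    ‖∑ i ∈ s, f i‖ ^ 2 = ∑ i ∈ s, ‖f i‖ ^ 2 := by
  rw [← real_inner_self_eq_norm_sq, sum_inner]
  refine Finset.sum_congr rfl fun i hi => ?_
  rw [inner_sum, Finset.sum_eq_single i (fun j hj hji => h i hi j hj hji.symm)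
    (fun hn => absurd hi hn), real_inner_self_eq_norm_sq]

/-- Comparison of the norms of two sums with orthogonal terms. -/
theorem norm_sum_le_norm_sum_of_orthogonal {ι : Type*} (s : Finset ι) (f g : ι → E)
    (hf : ∀ i ∈ s, ∀ j ∈ s, i ≠ j → inner ℝ (f i) (f j) = 0)
    (hg : ∀ i ∈ s, ∀ j ∈ s, i ≠ j → inner ℝ (g i) (g j) = 0)
    (hfg : ∀ i ∈ s, ‖f i‖ ≤ ‖g i‖) :
    ‖∑ i ∈ s, f i‖ ≤ ‖∑ i ∈ s, g i‖ := by
  rw [← sq_le_sq₀ (norm_nonneg _) (norm_nonneg _), norm_sq_sum_of_orthogonal s f hf,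
    norm_sq_sum_of_orthogonal s g hg]
  exact Finset.sum_le_sum fun i hi => by gcongr; exact hfg i hi

/-- An element of the sum of the eigenspaces selected by `p` is a finite sum of mutually
orthogonal eigenvectors. -/
theorem exists_orthogonal_eigenvectors {K : E →L[ℝ] E} (hK : K.IsSymmetric) (p : ℝ → Prop) {y : E}
    (hy : y ∈ ⨆ ν : {ν : ℝ // p ν}, Module.End.eigenspace (K : E →ₗ[ℝ] E) ν.1) :
    ∃ (s : Finset {ν : ℝ // p ν}) (f : {ν : ℝ // p ν} → E),
      (∀ i, K (f i) = i.1 • f i) ∧ (∀ i j, i ≠ j → inner ℝ (f i) (f j) = 0) ∧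
      ∑ i ∈ s, f i = y := by
  obtain ⟨f, hf, rfl⟩ := (Submodule.mem_iSup_iff_exists_finsupp _ _).1 hy
  have hf' : ∀ i, K (f i) = i.1 • f i := fun i => Module.End.mem_eigenspace_iff.1 (hf i)
  refine ⟨f.support, f, hf', fun i j hij => ?_, rfl⟩
  exact hK.orthogonalFamily_eigenspaces (Subtype.coe_injective.ne hij) ⟨f i, hf i⟩ ⟨f j, hf j⟩

theorem le_norm_apply_of_mem_iSup_eigenspace {K : E →L[ℝ] E} (hK : K.IsSymmetric) {c : ℝ}
    (hc : 0 ≤ c) {y : E}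
    (hy : y ∈ ⨆ ν : {ν : ℝ // c ≤ |ν|}, Module.End.eigenspace (K : E →ₗ[ℝ] E) ν.1) :
    c * ‖y‖ ≤ ‖K y‖ := by
  obtain ⟨s, f, hf, ho, rfl⟩ := exists_orthogonal_eigenvectors hK _ hy
  have h := norm_sum_le_norm_sum_of_orthogonal s (fun i => c • f i) (fun i => i.1 • f i)
    (fun i _ j _ hij => by simp [inner_smul_left, inner_smul_right, ho i j hij])
    (fun i _ j _ hij => by simp [inner_smul_left, inner_smul_right, ho i j hij])
    (fun i _ => by
      rw [norm_smul, norm_smul, Real.norm_eq_abs, Real.norm_eq_abs, abs_of_nonneg hc]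
      exact mul_le_mul_of_nonneg_right i.2 (norm_nonneg _))
  rw [← Finset.smul_sum, norm_smul, Real.norm_eq_abs, abs_of_nonneg hc] at h
  rwa [map_sum, Finset.sum_congr rfl fun i _ => hf i]

variable [CompleteSpace E]

/-- By the spectral theorem finite sums of orthogonal eigenvectors are dense. On such sums the bound
is termwise by Pythagoras, and it passes to the closure. -/
theorem le_norm_apply_sub_smul {K : E →L[ℝ] E} (hK : K.IsSymmetric)
    (hKc : IsCompactOperator K) {c μ : ℝ} (hc : 0 ≤ c)
    (h : ∀ (ν : ℝ) (y : E), y ≠ 0 → K y = ν • y → c ≤ |ν - μ|) (y : E) :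
    c * ‖y‖ ≤ ‖K y - μ • y‖ := by
  have hd : Dense ((⨆ ν, Module.End.eigenspace (K : E →ₗ[ℝ] E) ν : Submodule ℝ E) : Set E) :=
    Submodule.dense_iff_topologicalClosure_eq_top.2 (Submodule.topologicalClosure_eq_top_iff.2
      (ContinuousLinearMap.orthogonalComplement_iSup_eigenspaces_eq_bot hKc hK))
  refine hd.induction (P := fun y => c * ‖y‖ ≤ ‖K y - μ • y‖) ?_ ?_ y
  · intro y hy
    have hy' : y ∈ ⨆ ν : {ν : ℝ // True}, Module.End.eigenspace (K : E →ₗ[ℝ] E) ν.1 := by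
      simpa [iSup_subtype] using hy
    obtain ⟨s, f, hf, ho, rfl⟩ := exists_orthogonal_eigenvectors hK _ hy'
    have h := norm_sum_le_norm_sum_of_orthogonal s (fun i => c • f i) (fun i => (i.1 - μ) • f i)
      (fun i _ j _ hij => by simp [inner_smul_left, inner_smul_right, ho i j hij])
      (fun i _ j _ hij => by simp [inner_smul_left, inner_smul_right, ho i j hij])
      (fun i _ => by
        rw [norm_smul, norm_smul, Real.norm_eq_abs, Real.norm_eq_abs, abs_of_nonneg hc]
        by_cases h0 : f i = 0
        · simp [h0]
        · exact mul_le_mul_of_nonneg_right (h _ _ h0 (hf i)) (norm_nonneg _))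
    rw [← Finset.smul_sum, norm_smul, Real.norm_eq_abs, abs_of_nonneg hc] at h
    rw [map_sum, Finset.sum_congr rfl fun i _ => hf i, Finset.smul_sum, ← Finset.sum_sub_distrib]
    simpa only [sub_smul] using h
  · exact isClosed_le (by fun_prop) (by fun_prop)

theorem norm_apply_le_of_eigenvalues_le {K : E →L[ℝ] E} (hK : K.IsSymmetric)
    (hKc : IsCompactOperator K) {ρ : ℝ} (hρ : 0 ≤ ρ)
    (h : ∀ (ν : ℝ) (y : E), y ≠ 0 → K y = ν • y → |ν| ≤ ρ) (y : E) :
    ‖K y‖ ≤ ρ * ‖y‖ := by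
  have hd : Dense ((⨆ ν, Module.End.eigenspace (K : E →ₗ[ℝ] E) ν : Submodule ℝ E) : Set E) :=
    Submodule.dense_iff_topologicalClosure_eq_top.2 (Submodule.topologicalClosure_eq_top_iff.2
      (ContinuousLinearMap.orthogonalComplement_iSup_eigenspaces_eq_bot hKc hK))
  refine hd.induction (P := fun y => ‖K y‖ ≤ ρ * ‖y‖) ?_ ?_ y
  · intro y hy
    have hy' : y ∈ ⨆ ν : {ν : ℝ // True}, Module.End.eigenspace (K : E →ₗ[ℝ] E) ν.1 := by
      simpa [iSup_subtype] using hy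
    obtain ⟨s, f, hf, ho, rfl⟩ := exists_orthogonal_eigenvectors hK _ hy'
    have h := norm_sum_le_norm_sum_of_orthogonal s (fun i => i.1 • f i) (fun i => ρ • f i)
      (fun i _ j _ hij => by simp [inner_smul_left, inner_smul_right, ho i j hij])
      (fun i _ j _ hij => by simp [inner_smul_left, inner_smul_right, ho i j hij])
      (fun i _ => by
        rw [norm_smul, norm_smul, Real.norm_eq_abs, Real.norm_eq_abs, abs_of_nonneg hρ]
        by_cases h0 : f i = 0
        · simp [h0]
        · exact mul_le_mul_of_nonneg_right (h _ _ h0 (hf i)) (norm_nonneg _))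
    rw [← Finset.smul_sum, norm_smul ρ, Real.norm_eq_abs, abs_of_nonneg hρ] at h
    rwa [map_sum, Finset.sum_congr rfl fun i _ => hf i]
  · exact isClosed_le (by fun_prop) (by fun_prop)

omit [CompleteSpace E] in
/-- Lower bound for `K - μ` on an invariant closed subspace without eigenvalues near `μ`. -/
theorem le_norm_apply_sub_smul_of_mem {K : E →L[ℝ] E} (hK : K.IsSymmetric)
    (hKc : IsCompactOperator K) (V : Submodule ℝ E) [CompleteSpace V] (hV : ∀ y ∈ V, K y ∈ V)
    {c μ : ℝ} (hc : 0 ≤ c)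
    (h : ∀ (ν : ℝ) (y : E), y ∈ V → y ≠ 0 → K y = ν • y → c ≤ |ν - μ|) {y : E} (hy : y ∈ V) :
    c * ‖y‖ ≤ ‖K y - μ • y‖ := by
  let L : V →L[ℝ] V := K.restrict hV
  have hL : L.IsSymmetric := hK.restrict_invariant hV
  have hLc : IsCompactOperator L := hKc.restrict' hV
  refine le_norm_apply_sub_smul hL hLc hc (fun ν z hz hLz => ?_) ⟨y, hy⟩
  exact h ν z z.2 (by simpa using hz) (congrArg Subtype.val hLz)

omit [CompleteSpace E] in
/-- Bound for `K` on an invariant closed subspace in terms of its eigenvalues there. -/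
theorem norm_apply_le_of_eigenvalues_le_of_mem {K : E →L[ℝ] E} (hK : K.IsSymmetric)
    (hKc : IsCompactOperator K) (V : Submodule ℝ E) [CompleteSpace V] (hV : ∀ y ∈ V, K y ∈ V)
    {ρ : ℝ} (hρ : 0 ≤ ρ)
    (h : ∀ (ν : ℝ) (y : E), y ∈ V → y ≠ 0 → K y = ν • y → |ν| ≤ ρ) {y : E} (hy : y ∈ V) :
    ‖K y‖ ≤ ρ * ‖y‖ := by
  let L : V →L[ℝ] V := K.restrict hV
  have hL : L.IsSymmetric := hK.restrict_invariant hV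
  have hLc : IsCompactOperator L := hKc.restrict' hV
  refine norm_apply_le_of_eigenvalues_le hL hLc hρ (fun ν z hz hLz => ?_) ⟨y, hy⟩
  exact h ν z z.2 (by simpa using hz) (congrArg Subtype.val hLz)

/-- A subspace on which a compact operator is bounded below has finite dimension. -/
theorem finiteDimensional_of_le_norm_apply {K : E →L[ℝ] E} (hKc : IsCompactOperator K)
    (V : Submodule ℝ E) {c : ℝ} (hc : 0 < c) (h : ∀ y ∈ V, c * ‖y‖ ≤ ‖K y‖) :
    FiniteDimensional ℝ V := by
  let W := V.topologicalClosure
  have hW : ∀ y ∈ W, c * ‖y‖ ≤ ‖K y‖ := fun y hy =>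
    closure_minimal (t := {y | c * ‖y‖ ≤ ‖K y‖}) (fun y hy => h y hy)
      (isClosed_le (by fun_prop) (by fun_prop)) hy
  have : CompleteSpace W := V.isClosed_topologicalClosure.completeSpace_coe
  let L : W →L[ℝ] E := K.comp W.subtypeL
  have hL : AntilipschitzWith (Real.toNNReal c⁻¹) L :=
    AddMonoidHomClass.antilipschitz_of_bound L fun x => by
      rw [Real.coe_toNNReal _ (inv_nonneg.2 hc.le), inv_mul_eq_div, le_div_iff₀ hc, mul_comm]
      exact hW x x.2
  have hemb := hL.isClosedEmbedding L.uniformContinuous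
  obtain ⟨Q, hQ, hQ0⟩ := hKc.comp_clm W.subtypeL
  -- `K` is a closed embedding of the closure of `V`, so compactness pulls back to the identity, and
  -- Riesz's theorem applies.
  have hid : IsCompactOperator (id : W → W) := ⟨_, hemb.isCompact_preimage hQ, hQ0⟩
  have : FiniteDimensional ℝ W := FiniteDimensional.of_isCompactOperator_id (𝕜 := ℝ) hid
  exact Submodule.finiteDimensional_of_le V.le_topologicalClosure

theorem finiteDimensional_iSup_eigenspace {K : E →L[ℝ] E} (hK : K.IsSymmetric)
    (hKc : IsCompactOperator K) {c : ℝ} (hc : 0 < c) :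
    FiniteDimensional ℝ
      ↥(⨆ ν : {ν : ℝ // c ≤ |ν|}, Module.End.eigenspace (K : E →ₗ[ℝ] E) ν.1) :=
  finiteDimensional_of_le_norm_apply hKc _ hc fun _ hy =>
    le_norm_apply_of_mem_iSup_eigenspace hK hc.le hy

theorem finite_eigenvalues {K : E →L[ℝ] E} (hK : K.IsSymmetric)
    (hKc : IsCompactOperator K) {c : ℝ} (hc : 0 < c) :
    {ν : ℝ | c ≤ |ν| ∧ Module.End.eigenspace (K : E →ₗ[ℝ] E) ν ≠ ⊥}.Finite := by
  let F := ⨆ ν : {ν : ℝ // c ≤ |ν|}, Module.End.eigenspace (K : E →ₗ[ℝ] E) ν.1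
  have : FiniteDimensional ℝ F := finiteDimensional_iSup_eigenspace hK hKc hc
  let A : Set ℝ := {ν : ℝ | c ≤ |ν| ∧ Module.End.eigenspace (K : E →ₗ[ℝ] E) ν ≠ ⊥}
  have hex : ∀ ν : A, ∃ y, Module.End.HasEigenvector (K : E →ₗ[ℝ] E) ν.1 y := fun ν =>
    Module.End.HasEigenvalue.exists_hasEigenvector (Module.End.hasEigenvalue_iff.2 ν.2.2)
  choose y hy using hex
  have hmem : ∀ ν, y ν ∈ F := fun ν =>
    Submodule.mem_iSup_of_mem (⟨ν.1, ν.2.1⟩ : {ν : ℝ // c ≤ |ν|}) (hy ν).1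
  have hli : LinearIndependent ℝ fun ν => (⟨y ν, hmem ν⟩ : F) :=
    LinearIndependent.of_comp F.subtype
      (Module.End.eigenvectors_linearIndependent' (K : E →ₗ[ℝ] E) Subtype.val
        Subtype.coe_injective y hy)
  have : Finite A := hli.finite
  exact Set.toFinite A

end Hilbert
-- Factorization of a semidefinite form through a Hilbert space
section Factorization

/-- A positive semidefinite form is the pull-back of the inner product of a Hilbert space. -/
theorem exists_linearMap_inner_eq.{u} {V : Type u} [AddCommGroup V] [Module ℝ V]
    (B : V →ₗ[ℝ] V →ₗ[ℝ] ℝ) (hB : ∀ v w, B v w = B w v) (hB0 : ∀ v, 0 ≤ B v v) :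
    ∃ (E : Type u) (_ : NormedAddCommGroup E) (_ : InnerProductSpace ℝ E) (_ : CompleteSpace E)
      (S : V →ₗ[ℝ] E), ∀ v w, inner ℝ (S v) (S w) = B v w := by
  let cd : PreInnerProductSpace.Core ℝ V :=
    { inner := fun v w => B v w
      conj_inner_symm := fun v w => hB w v
      re_inner_nonneg := hB0
      add_left := fun u v w => by simp
      smul_left := fun u v r => by simp }
  let : SeminormedAddCommGroup V := InnerProductSpace.Core.toSeminormedAddCommGroup (c := cd)
  let : InnerProductSpace ℝ V := InnerProductSpace.ofCore cd
  -- The completion of a seminormed space is separated: vectors null for `B` become zero, so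
  -- definiteness is not needed.
  exact ⟨UniformSpace.Completion V, inferInstance, inferInstance, inferInstance,
    (UniformSpace.Completion.toComplL (𝕜 := ℝ) (E := V) : V →ₗ[ℝ] UniformSpace.Completion V),
    fun v w => UniformSpace.Completion.inner_coe v w⟩

theorem exists_continuousLinearMap_inner_eq.{u} {H : Type u} [NormedAddCommGroup H]
    [InnerProductSpace ℝ H] (b : H →L[ℝ] H →L[ℝ] ℝ)
    (hb : ∀ v w, b v w = b w v) (hb0 : ∀ v, 0 ≤ b v v) :
    ∃ (E : Type u) (_ : NormedAddCommGroup E) (_ : InnerProductSpace ℝ E) (_ : CompleteSpace E)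
      (S : H →L[ℝ] E), ∀ v w, inner ℝ (S v) (S w) = b v w := by
  obtain ⟨E, _, _, _, S, hS⟩ := exists_linearMap_inner_eq
    ((ContinuousLinearMap.coeLM ℝ).comp (b : H →ₗ[ℝ] H →L[ℝ] ℝ)) hb hb0
  refine ⟨E, _, _, ‹_›, S.mkContinuous √‖b‖ fun v => ?_, hS⟩
  rw [← sq_le_sq₀ (norm_nonneg _) (by positivity), mul_pow, Real.sq_sqrt (norm_nonneg b),
    ← real_inner_self_eq_norm_sq, hS]
  have h := b.le_opNorm₂ v v
  calc b v v ≤ ‖b v v‖ := le_abs_self _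
    _ ≤ _ := by rw [sq, ← mul_assoc]; exact h

end Factorization

/-- On a bounded set, points with close images under `T` have close images under `S`, so finite nets
transfer. It is meant for `‖S x‖² = b(x, x) = a(T x, x) ≤ ‖a‖ ‖T x‖ ‖x‖`. -/
theorem isCompactOperator_of_norm_sq_le {H E F : Type*} [NormedAddCommGroup H] [NormedSpace ℝ H]
    [NormedAddCommGroup E] [NormedSpace ℝ E] [CompleteSpace E]
    [NormedAddCommGroup F] [NormedSpace ℝ F]
    {S : H →L[ℝ] E} {T : H →L[ℝ] F} (hT : IsCompactOperator T) {c : ℝ}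
    (h : ∀ x, ‖S x‖ ^ 2 ≤ c * ‖T x‖ * ‖x‖) : IsCompactOperator S := by
  have hc : ∀ x, ‖S x‖ ^ 2 ≤ |c| * ‖T x‖ * ‖x‖ := fun x => (h x).trans (by
    gcongr; exact le_abs_self c)
  refine (isCompactOperator_iff_isCompact_closure_image_ball (S : H →ₗ[ℝ] E) one_pos).2 ?_
  refine TotallyBounded.isCompact_of_isClosed (TotallyBounded.closure ?_) isClosed_closure
  have hTt : TotallyBounded (T '' Metric.ball 0 1) :=
    (IsCompactOperator.isCompact_closure_image_ball (f := (T : H →ₗ[ℝ] F)) hT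
      1).totallyBounded.subset subset_closure
  refine Metric.totallyBounded_iff.2 fun ε hε => ?_
  -- The factor 2 bounds the distance of two points of the unit ball.
  obtain ⟨δ, hδ, hδε⟩ : ∃ δ > 0, |c| * δ * 2 < ε ^ 2 := by
    refine ⟨ε ^ 2 / (4 * (|c| + 1)), by positivity, ?_⟩
    rw [mul_div_assoc', div_mul_eq_mul_div, div_lt_iff₀ (by positivity)]
    nlinarith [abs_nonneg c, sq_pos_of_pos hε, mul_nonneg (abs_nonneg c) (sq_nonneg ε)]
  obtain ⟨t, hts, htf, htc⟩ := Metric.finite_approx_of_totallyBounded hTt δ hδ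
  have hts' : ∀ y, y ∈ t → ∃ x, x ∈ Metric.ball (0 : H) 1 ∧ T x = y := fun y hy => hts hy
  choose! x hx using hts'
  refine ⟨(fun y => S (x y)) '' t, htf.image _, ?_⟩
  rintro _ ⟨z, hz, rfl⟩
  obtain ⟨y, hy, hzy⟩ := Set.mem_iUnion₂.1 (htc ⟨z, hz, rfl⟩)
  refine Set.mem_iUnion₂.2 ⟨S (x y), ⟨y, hy, rfl⟩, ?_⟩
  have hxy := hx y hy
  rw [Metric.mem_ball, dist_eq_norm] at hzy ⊢
  rw [← hxy.2, ← map_sub] at hzy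
  change ‖S z - S (x y)‖ < ε
  rw [← map_sub, ← sq_lt_sq₀ (norm_nonneg _) hε.le]
  have h2 : ‖z - x y‖ ≤ 2 := by
    have h3 := norm_sub_le z (x y)
    have h4 := mem_ball_zero_iff.1 hz
    have h5 := mem_ball_zero_iff.1 hxy.1
    linarith
  calc _ ≤ |c| * ‖T (z - x y)‖ * ‖z - x y‖ := hc _
    _ ≤ |c| * δ * 2 := by gcongr
    _ < _ := hδε

theorem apply_mem_span_of_eigenvectors {V ι : Type*} [AddCommGroup V] [Module ℝ V]
    {L : V →ₗ[ℝ] V} {ν : ι → ℝ} {w : ι → V} (hw : ∀ j, L (w j) = ν j • w j) {x : V}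
    (hx : x ∈ Submodule.span ℝ (Set.range w)) : L x ∈ Submodule.span ℝ (Set.range w) := by
  refine Submodule.mem_comap.1 ((Submodule.span_le (p := Submodule.comap L _)).2 ?_ hx)
  rintro _ ⟨j, rfl⟩
  rw [SetLike.mem_coe, Submodule.mem_comap, hw]
  exact Submodule.smul_mem _ _ (Submodule.subset_span ⟨j, rfl⟩)

/-! ### Spectral gap and perturbation of the first eigenvalues -/

section Hilbert

variable {E : Type*} [NormedAddCommGroup E] [InnerProductSpace ℝ E] [CompleteSpace E]

omit [CompleteSpace E] in
theorem apply_mem_orthogonal {K : E →L[ℝ] E} (hK : K.IsSymmetric) {V : Submodule ℝ E}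
    (hV : ∀ y ∈ V, K y ∈ V) {z : E} (hz : z ∈ Vᗮ) : K z ∈ Vᗮ := by
  rw [Submodule.mem_orthogonal] at hz ⊢
  intro u hu
  rw [← hz (K u) (hV u hu)]
  exact (hK u z).symm

/-- Eigenvalues accumulate only at zero, so those of modulus below `c` stay away from `c`; on the
complement of the remaining eigenspaces they determine the norm. -/
theorem exists_norm_apply_le_of_mem_orthogonal {K : E →L[ℝ] E} (hK : K.IsSymmetric)
    (hKc : IsCompactOperator K) {c : ℝ} (hc : 0 < c) :
    ∃ ρ, 0 ≤ ρ ∧ ρ < c ∧ ∀ y ∈ (⨆ ν : {ν : ℝ // c ≤ |ν|},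
      Module.End.eigenspace (K : E →ₗ[ℝ] E) ν.1)ᗮ, ‖K y‖ ≤ ρ * ‖y‖ := by
  obtain ⟨ρ, hρ, hρc, h⟩ : ∃ ρ, 0 ≤ ρ ∧ ρ < c ∧ ∀ ν : ℝ,
      Module.End.eigenspace (K : E →ₗ[ℝ] E) ν ≠ ⊥ → |ν| < c → |ν| ≤ ρ := by
    have hfin := (finite_eigenvalues hK hKc (half_pos hc)).subset
      (Set.inter_subset_left (t := {ν | |ν| < c}))
    -- Inserting `c / 2` makes the set nonempty and covers all eigenvalues of modulus below `c / 2`.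
    have hfin' := (hfin.image (fun ν : ℝ => |ν|)).insert (c / 2)
    obtain ⟨ρ, hρ, hmax⟩ := Set.exists_max_image _ id hfin' (Set.insert_nonempty _ _)
    refine ⟨ρ, (half_pos hc).le.trans (hmax _ (Set.mem_insert _ _)), ?_, fun ν hν hνc => ?_⟩
    · rcases hρ with rfl | ⟨ν, hν, rfl⟩
      · exact half_lt_self hc
      · exact hν.2
    · rcases le_total (c / 2) |ν| with h | h
      · exact hmax _ (Set.mem_insert_of_mem _ ⟨ν, ⟨⟨h, hν⟩, hνc⟩, rfl⟩)
      · exact h.trans (hmax _ (Set.mem_insert _ _))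
  refine ⟨ρ, hρ, hρc, fun y hy => ?_⟩
  refine norm_apply_le_of_eigenvalues_le_of_mem hK hKc _ (fun z hz => ?_) hρ
    (fun ν z hz hz0 hKz => ?_) hy
  · refine apply_mem_orthogonal hK (fun u hu => ?_) hz
    have hle : (⨆ ν : {ν : ℝ // c ≤ |ν|}, Module.End.eigenspace (K : E →ₗ[ℝ] E) ν.1) ≤
        Submodule.comap (K : E →ₗ[ℝ] E)
          (⨆ ν : {ν : ℝ // c ≤ |ν|}, Module.End.eigenspace (K : E →ₗ[ℝ] E) ν.1) := by
      refine iSup_le fun ν u hu => Submodule.mem_comap.2 (Submodule.mem_iSup_of_mem ν ?_)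
      rw [Module.End.mem_eigenspace_iff.1 hu]
      exact Submodule.smul_mem _ _ hu
    exact hle hu
  · have hm : z ∈ Module.End.eigenspace (K : E →ₗ[ℝ] E) ν := Module.End.mem_eigenspace_iff.2 hKz
    refine h ν (fun h0 => hz0 ?_) (lt_of_not_ge fun hcν => hz0 ?_)
    · rwa [h0, Submodule.mem_bot] at hm
    · exact inner_self_eq_zero.1 ((Submodule.mem_orthogonal _ z).1 hz z
        (Submodule.mem_iSup_of_mem (⟨ν, hcν⟩ : {ν : ℝ // c ≤ |ν|}) hm))

omit [CompleteSpace E] in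
/-- If `F` is a subspace of dimension at most `k` on whose complement `K` is small, then no
perturbation of `K` has `k + 1` orthogonal eigenvectors with large eigenvalues. -/
theorem exists_eigenvalue_le_of_finrank_le {K L : E →L[ℝ] E} {F : Submodule ℝ E}
    [FiniteDimensional ℝ F] {ρ η : ℝ} (hF : ∀ y ∈ Fᗮ, ‖K y‖ ≤ ρ * ‖y‖)
    (hKL : ‖K - L‖ ≤ η) {k : ℕ} (hk : Module.finrank ℝ F < k) {ν : Fin k → ℝ} {w : Fin k → E}
    (hw : ∀ j, L (w j) = ν j • w j) (hli : LinearIndependent ℝ w)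
    (ho : ∀ i j, i ≠ j → inner ℝ (w i) (w j) = 0) (hc : 0 ≤ ρ + η) : ∃ j, |ν j| ≤ ρ + η := by
  by_contra! hcon
  -- There are more eigenvectors than dimensions of `F`, so some nontrivial combination `z` lies in
  -- `Fᗮ`. There `‖L z‖ ≤ (ρ + η) ‖z‖`, while Pythagoras gives the strict reverse if all eigenvalues
  -- are larger.
  let A : (Fin k → ℝ) →ₗ[ℝ] F :=
    (F.orthogonalProjectionOnto : E →ₗ[ℝ] F).comp (Fintype.linearCombination ℝ w)
  have hA : LinearMap.ker A ≠ ⊥ := LinearMap.ker_ne_bot_of_finrank_lt (by simpa using hk)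
  obtain ⟨g, hg, hg0⟩ := (Submodule.ne_bot_iff _).1 hA
  set z := ∑ j, g j • w j with hz
  have hzF : z ∈ Fᗮ := by
    rw [← Submodule.orthogonalProjectionOnto_eq_zero_iff]
    exact hg
  have hz0 : z ≠ 0 := fun h0 => hg0 (funext (Fintype.linearIndependent_iff.1 hli g h0))
  have h1 : ‖L z‖ ≤ (ρ + η) * ‖z‖ := by
    have h2 : L z = K z - (K - L) z := by simp
    have h3 := (K - L).le_of_opNorm_le hKL z
    have h4 := hF z hzF
    rw [h2]
    linarith [norm_sub_le (K z) ((K - L) z)]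
  obtain ⟨i, hi⟩ : ∃ i, g i ≠ 0 := by
    by_contra! h; exact hg0 (funext h)
  have h5 : ‖L z‖ ^ 2 = ∑ j, ‖ν j • g j • w j‖ ^ 2 := by
    rw [hz, map_sum, ← norm_sq_sum_of_orthogonal]
    · congr 2
      exact Finset.sum_congr rfl fun j _ => by rw [map_smul, hw, smul_comm]
    · intro i _ j _ hij
      simp [inner_smul_left, inner_smul_right, ho i j hij]
  have h6 : ‖(ρ + η) • z‖ ^ 2 = ∑ j, ‖(ρ + η) • g j • w j‖ ^ 2 := by
    rw [hz, Finset.smul_sum, ← norm_sq_sum_of_orthogonal]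
    intro i _ j _ hij
    simp [inner_smul_left, inner_smul_right, ho i j hij]
  have h7 : ∑ j, ‖(ρ + η) • g j • w j‖ ^ 2 < ∑ j, ‖ν j • g j • w j‖ ^ 2 := by
    refine Finset.sum_lt_sum (fun j _ => ?_) ⟨i, Finset.mem_univ i, ?_⟩
    · rw [norm_smul, norm_smul (ν j), Real.norm_eq_abs, Real.norm_eq_abs, abs_of_nonneg hc]
      gcongr
      exact (hcon j).le
    · rw [norm_smul, norm_smul (ν i), Real.norm_eq_abs, Real.norm_eq_abs, abs_of_nonneg hc]
      have : 0 < ‖g i • w i‖ := norm_pos_iff.2 (smul_ne_zero hi (hli.ne_zero i))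
      gcongr
      exact hcon i
  rw [← h5, ← h6, norm_smul, Real.norm_eq_abs, abs_of_nonneg hc,
    sq_lt_sq₀ (by positivity) (norm_nonneg _)] at h7
  exact absurd h1 (not_le.2 h7)

/-- On the orthogonal complement of the first `k` eigenvectors of a perturbation `L` of `K`,
the operator `L - μ` is bounded below. -/
theorem le_norm_apply_sub_smul_of_mem_orthogonal_span {K L : E →L[ℝ] E} {F : Submodule ℝ E}
    [FiniteDimensional ℝ F] {ρ η μ : ℝ} (hF : ∀ y ∈ Fᗮ, ‖K y‖ ≤ ρ * ‖y‖) (hρ : 0 ≤ ρ) (hη : 0 ≤ η)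
    (hμ : ρ + 2 * η < |μ|) (hKL : ‖K - L‖ ≤ η) (hL : L.IsSymmetric) (hLc : IsCompactOperator L)
    {k : ℕ} (hk : Module.finrank ℝ F ≤ k) {ν : Fin k → ℝ} {w : Fin k → E}
    (hw : ∀ j, L (w j) = ν j • w j) (hli : LinearIndependent ℝ w)
    (ho : ∀ i j, i ≠ j → inner ℝ (w i) (w j) = 0)
    (hmax : ∀ (ν' : ℝ) (y : E), y ≠ 0 → ν' ≠ 0 → L y = ν' • y →
      y ∉ Submodule.span ℝ (Set.range w) → ∀ j, |ν'| ≤ |ν j|)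
    {y : E} (hy : y ∈ (Submodule.span ℝ (Set.range w))ᗮ) : η * ‖y‖ ≤ ‖L y - μ • y‖ := by
  have hinv := fun y => apply_mem_span_of_eigenvectors (L := (L : E →ₗ[ℝ] E)) (x := y) hw
  refine le_norm_apply_sub_smul_of_mem hL hLc _ (fun z hz => ?_) hη (fun ν' z hz hz0 hLz => ?_) hy
  · exact apply_mem_orthogonal hL hinv hz
  -- An eigenvalue `ν'` within `η` of `μ` has modulus above `ρ + η`, and by maximality so has every
  -- `ν j`. With `z` prepended this makes `k + 1` orthogonal eigenvectors, too many for `F`.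
  · by_contra! hlt
    have hν' : ρ + η < |ν'| := by
      have := abs_sub_abs_le_abs_sub μ ν'
      rw [abs_sub_comm] at this
      linarith
    have hzs : z ∉ Submodule.span ℝ (Set.range w) := fun hm =>
      hz0 (inner_self_eq_zero.1 ((Submodule.mem_orthogonal _ z).1 hz z hm))
    have hν0 : ν' ≠ 0 := fun h0 => by rw [h0, abs_zero] at hν'; linarith
    have hj := hmax ν' z hz0 hν0 hLz hzs
    have hzw : ∀ j, inner ℝ (w j) z = 0 := fun j =>
      (Submodule.mem_orthogonal _ z).1 hz _ (Submodule.subset_span ⟨j, rfl⟩)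
    obtain ⟨j, hj'⟩ := exists_eigenvalue_le_of_finrank_le hF hKL (Nat.lt_succ_of_le hk)
      (ν := Fin.cons ν' ν) (w := Fin.cons z w)
      (fun j => by refine Fin.cases ?_ (fun j => ?_) j <;> simp [hLz, hw])
      (linearIndependent_finCons.2 ⟨hli, hzs⟩)
      (fun i j => by
        refine Fin.cases ?_ (fun i => ?_) i <;> refine Fin.cases ?_ (fun j => ?_) j <;> intro hij
        · exact absurd rfl hij
        · simpa [real_inner_comm] using hzw j
        · simpa using hzw i
        · simpa using ho i j (fun h => hij (by rw [h]))) (by linarith)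
    revert hj'
    refine Fin.cases ?_ (fun j => ?_) j
    · simpa using hν'
    · simpa using hν'.trans_le (hj j)

end Hilbert
-- Projections defined by an indefinite stable form
section Galerkin

variable {H : Type*} [NormedAddCommGroup H] [InnerProductSpace ℝ H] [CompleteSpace H]

omit [CompleteSpace H] in
theorem InfSup.eq_of_forall {a : H →L[ℝ] H →L[ℝ] ℝ} {G : Submodule ℝ H} {C : ℝ}
    (h : InfSup a G C) (hC : 0 < C) {x y : H} (hx : x ∈ G) (hy : y ∈ G)
    (hxy : ∀ v ∈ G, a x v = a y v) : x = y := by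
  have h0 : (a (x - y)).comp G.subtypeL = 0 := by
    ext v
    simp [hxy v v.2]
  have h1 := h _ (G.sub_mem hx hy)
  have h2 : ‖(a (x - y)).comp G.subtypeL‖ = 0 :=
    (congrArg norm h0).trans ContinuousLinearMap.opNorm_zero
  rw [h2] at h1
  exact sub_eq_zero.1 (norm_le_zero_iff.1 (nonpos_of_mul_nonpos_right h1 hC))

theorem apply_solutionOp {a b : H →L[ℝ] H →L[ℝ] ℝ} (ha : ∀ v w, a v w = a w v) {C : ℝ}
    (hC : 0 < C) (h : InfSup a ⊤ C) (w v : H) : a (solutionOp a b w) v = b w v :=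
  (galerkinOp_spec a b ha ⊤ isClosed_univ hC h w).2 v trivial

variable {a : H →L[ℝ] H →L[ℝ] ℝ} (ha : ∀ v w, a v w = a w v) {G : Submodule ℝ H}
  (hG : IsClosed (G : Set H)) {C : ℝ} (hC : 0 < C) (h : InfSup a G C)
include ha hG hC h

theorem ritzProj_mem (w : H) : ritzProj a G w ∈ G := (galerkinOp_spec a a ha G hG hC h w).1

theorem apply_ritzProj (w : H) {v : H} (hv : v ∈ G) : a (ritzProj a G w) v = a w v :=
  (galerkinOp_spec a a ha G hG hC h w).2 v hv

theorem eq_ritzProj {x w : H} (hx : x ∈ G) (hxw : ∀ v ∈ G, a x v = a w v) :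
    x = ritzProj a G w :=
  h.eq_of_forall hC hx (ritzProj_mem ha hG hC h w) fun v hv => by
    rw [hxw v hv, apply_ritzProj ha hG hC h w hv]

theorem ritzProj_of_mem {x : H} (hx : x ∈ G) : ritzProj a G x = x :=
  (eq_ritzProj ha hG hC h hx fun _ _ => rfl).symm

theorem ritzProj_ritzProj_of_le {G' : Submodule ℝ H} (hG' : IsClosed (G' : Set H)) {C' : ℝ}
    (hC' : 0 < C') (h' : InfSup a G' C') (hle : G ≤ G') (w : H) :
    ritzProj a G (ritzProj a G' w) = ritzProj a G w :=
  (eq_ritzProj ha hG hC h (ritzProj_mem ha hG hC h _) fun v hv => by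
    rw [apply_ritzProj ha hG hC h _ hv, apply_ritzProj ha hG' hC' h' _ (hle hv)])

theorem norm_ritzProj_le (w : H) : ‖ritzProj a G w‖ ≤ ‖a‖ / C * ‖w‖ := by
  have h1 := h _ (ritzProj_mem ha hG hC h w)
  have h2 : (a (ritzProj a G w)).comp G.subtypeL = (a w).comp G.subtypeL := by
    ext v
    exact apply_ritzProj ha hG hC h w v.2
  rw [h2] at h1
  have h3 : ‖(a w).comp G.subtypeL‖ ≤ ‖a‖ * ‖w‖ :=
    ((a w).opNorm_comp_le G.subtypeL).trans (by
      calc ‖a w‖ * ‖G.subtypeL‖ ≤ ‖a w‖ * 1 := by gcongr; exact G.norm_subtypeL_le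
        _ ≤ ‖a‖ * ‖w‖ := by rw [mul_one]; exact a.le_opNorm w)
  rw [div_mul_eq_mul_div, le_div_iff₀ hC, mul_comm]
  exact h1.trans h3

theorem norm_sub_ritzProj_le (w : H) : ‖w - ritzProj a G w‖ ≤ (1 + ‖a‖ / C) * ‖w‖ := by
  linarith [norm_sub_le w (ritzProj a G w), norm_ritzProj_le ha hG hC h w]

/-- Quasi-optimality of the `a`-projection. -/
theorem norm_sub_ritzProj_le_infDist (w : H) :
    ‖w - ritzProj a G w‖ ≤ (1 + ‖a‖ / C) * Metric.infDist w (G : Set H) := by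
  have hpos : 0 < 1 + ‖a‖ / C := by positivity
  rw [← div_le_iff₀' hpos]
  refine (Metric.le_infDist ⟨0, G.zero_mem⟩).2 fun g hg => ?_
  rw [div_le_iff₀' hpos, dist_eq_norm]
  -- The projection fixes `g`, so `w` and `w - g` have the same error.
  have h1 := norm_sub_ritzProj_le ha hG hC h (w - g)
  rwa [map_sub, ritzProj_of_mem ha hG hC h hg, sub_sub_sub_cancel_right] at h1

end Galerkin

/-! ### Elementary bounds for the gap -/

section Gap

variable {H : Type*} [NormedAddCommGroup H] [InnerProductSpace ℝ H]

theorem infDist_le_norm (G : Submodule ℝ H) (x : H) : Metric.infDist x (G : Set H) ≤ ‖x‖ := by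
  simpa using Metric.infDist_le_dist_of_mem (x := x) G.zero_mem

theorem gap_nonneg (M G : Submodule ℝ H) : 0 ≤ gap M G :=
  Real.sSup_nonneg (by rintro _ ⟨x, -, rfl⟩; exact Metric.infDist_nonneg)

theorem infDist_le_gap {M G : Submodule ℝ H} {x : H} (hx : x ∈ M) (hx1 : ‖x‖ = 1) :
    Metric.infDist x (G : Set H) ≤ gap M G :=
  le_csSup ⟨1, by rintro _ ⟨y, hy, rfl⟩; exact (infDist_le_norm G y).trans hy.2.le⟩
    ⟨x, ⟨hx, hx1⟩, rfl⟩

theorem gap_le {M G : Submodule ℝ H} {r : ℝ} (hr : 0 ≤ r)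
    (h : ∀ x ∈ M, ‖x‖ = 1 → Metric.infDist x (G : Set H) ≤ r) : gap M G ≤ r :=
  Real.sSup_le (by rintro _ ⟨x, hx, rfl⟩; exact h x hx.1 hx.2) hr

end Gap

/-! ### From `H` to the auxiliary Hilbert space and back -/

section DiscreteSpectrum

/-- `Φ` maps each eigenspace of `S Φ` with nonzero eigenvalue onto that of `Φ S`, and is injective
on their sum since `S Φ` is bounded below there. This carries the condition on `k` from `T` to `K`.
-/
theorem finrank_iSup_eigenspace_comp_le {H E : Type*} [NormedAddCommGroup H] [NormedSpace ℝ H]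
    [NormedAddCommGroup E] [InnerProductSpace ℝ E] [CompleteSpace E] (S : H →L[ℝ] E)
    (Φ : E →L[ℝ] H) (hK : (S.comp Φ).IsSymmetric) (hKc : IsCompactOperator (S.comp Φ))
    {c : ℝ} (hc : 0 < c) :
    Module.finrank ℝ ↥(⨆ ν : {ν : ℝ // c ≤ |ν|},
      Module.End.eigenspace ((S.comp Φ : E →L[ℝ] E) : E →ₗ[ℝ] E) ν.1) ≤
    Module.finrank ℝ ↥(⨆ ν : {ν : ℝ // c ≤ |ν|},
      Module.End.eigenspace ((Φ.comp S : H →L[ℝ] H) : H →ₗ[ℝ] H) ν.1) := by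
  set F := ⨆ ν : {ν : ℝ // c ≤ |ν|},
    Module.End.eigenspace ((S.comp Φ : E →L[ℝ] E) : E →ₗ[ℝ] E) ν.1 with hF
  have : FiniteDimensional ℝ F := finiteDimensional_iSup_eigenspace hK hKc hc
  have hinj : Function.Injective ((Φ : E →ₗ[ℝ] H).domRestrict F) := by
    rw [← LinearMap.ker_eq_bot, LinearMap.ker_eq_bot']
    intro y hy
    have h1 := le_norm_apply_of_mem_iSup_eigenspace hK hc.le y.2
    have h2 : S.comp Φ y = 0 := by
      have : Φ y = 0 := hy
      simp [this]
    rw [h2, norm_zero] at h1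
    exact Subtype.ext (norm_le_zero_iff.1 (nonpos_of_mul_nonpos_right h1 hc))
  have hmap : F.map (Φ : E →ₗ[ℝ] H) = ⨆ ν : {ν : ℝ // c ≤ |ν|},
      Module.End.eigenspace ((Φ.comp S : H →L[ℝ] H) : H →ₗ[ℝ] H) ν.1 := by
    rw [hF, Submodule.map_iSup]
    congr 1
    ext ν x
    have hν : ν.1 ≠ 0 := abs_pos.1 (hc.trans_le ν.2)
    simp only [Submodule.mem_map, Module.End.mem_eigenspace_iff, ContinuousLinearMap.coe_coe,
      ContinuousLinearMap.comp_apply]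
    constructor
    · rintro ⟨y, hy, rfl⟩
      rw [hy, map_smul]
    · intro hx
      refine ⟨ν.1⁻¹ • S x, ?_, ?_⟩
      · rw [map_smul, map_smul, hx, map_smul, smul_comm]
      · rw [map_smul, hx, inv_smul_smul₀ hν]
  rw [← hmap, ← LinearMap.range_domRestrict]
  exact (LinearMap.finrank_range_of_inj hinj).ge

variable {H : Type*} [NormedAddCommGroup H] [InnerProductSpace ℝ H] [CompleteSpace H]

/-- Uniform stability of the discrete spectral problems: modulo the span of the first eigenvectors
on `G`, the error is controlled by the eigenvalue residual. -/
theorem exists_norm_sub_le_residual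
    (a b : H →L[ℝ] H →L[ℝ] ℝ)
    (ha : ∀ v w, a v w = a w v) (hb : ∀ v w, b v w = b w v) (hb0 : ∀ v, 0 ≤ b v v)
    {C : ℝ} (hC : 0 < C) (hInf : InfSup a ⊤ C) (hT : IsCompactOperator (solutionOp a b))
    {μ : ℝ} (hμ : μ ≠ 0) {C' : ℝ} (hC' : 0 < C') :
    ∃ c ε : ℝ, 0 < c ∧ 0 < ε ∧ ∀ (G : Submodule ℝ H), IsClosed (G : Set H) → InfSup a G C' →
      ‖solutionOp a b - (ritzProj a G).comp (solutionOp a b)‖ < ε →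
      ∀ (k : ℕ) (ν : Fin k → ℝ) (u : Fin k → H),
        Module.finrank ℝ ↥(⨆ ν' : {ν' : ℝ // |μ| ≤ |ν'|},
          Module.End.eigenspace (solutionOp a b : H →ₗ[ℝ] H) ν'.1) ≤ k →
        IsFirstEigenpairs a b G ν u → (∀ j, ν j ≠ 0) →
        ∀ x ∈ G, ∃ q ∈ Submodule.span ℝ (Set.range u),
          ‖x - q‖ ≤ c * ‖ritzProj a G (solutionOp a b x) - μ • x‖ := by
  obtain ⟨E, _, _, _, S, hS⟩ := exists_continuousLinearMap_inner_eq b hb hb0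
  set T := solutionOp a b with hTdef
  have haT : ∀ w v, a (T w) v = b w v := apply_solutionOp ha hC hInf
  obtain ⟨Φ, hΦ⟩ : ∃ Φ : E →L[ℝ] H, ∀ y v, a (Φ y) v = inner ℝ y (S v) :=
    ⟨(galerkinOp a (innerSL ℝ) ⊤).comp S.adjoint, fun y v =>
      ((galerkinOp_spec a (innerSL ℝ) ha ⊤ isClosed_univ hC hInf _).2 v trivial).trans
        (S.adjoint_inner_left v y)⟩
  have hΦS : Φ.comp S = T := by
    ext w
    refine hInf.eq_of_forall hC trivial trivial fun v _ => ?_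
    rw [ContinuousLinearMap.comp_apply, hΦ, hS, haT]
  have hSc : IsCompactOperator S := isCompactOperator_of_norm_sq_le hT (c := ‖a‖) fun x => by
    rw [← real_inner_self_eq_norm_sq, hS, ← haT]
    exact (le_abs_self _).trans (a.le_opNorm₂ _ _)
  have hμ0 : 0 < |μ| := abs_pos.2 hμ
  have hK : (S.comp Φ).IsSymmetric := fun y z => by
    change inner ℝ (S (Φ y)) z = inner ℝ y (S (Φ z))
    rw [real_inner_comm, ← hΦ, ← hΦ, ha]
  have hKc : IsCompactOperator (S.comp Φ) := hSc.comp_clm Φ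
  have hdim := finrank_iSup_eigenspace_comp_le S Φ hK hKc hμ0
  have := finiteDimensional_iSup_eigenspace hK hKc hμ0
  obtain ⟨ρ, hρ, hρμ, hρF⟩ := exists_norm_apply_le_of_mem_orthogonal hK hKc hμ0
  rw [hΦS] at hdim
  -- With `|μ| = ρ + 3η`, one `η` is spent on the perturbation `K - L`, one on the distance to `μ`,
  -- and one keeps the inequality strict.
  set η := (|μ| - ρ) / 3 with hη
  have hη0 : 0 < η := by rw [hη]; linarith
  set p := ‖a‖ / C' with hp
  have hp0 : 0 ≤ p := by positivity
  set M := ‖S‖ * ((1 + p) * ‖Φ‖) with hM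
  have hM0 : 0 ≤ M := by positivity
  -- `M` is the factor in `‖(K - L)²‖ ≤ M ‖T - P T‖`, so this `ε` gives `‖K - L‖ ≤ η`.
  refine ⟨(p * (‖Φ‖ * (‖S‖ / η)) + 1) / |μ|, η ^ 2 / (M + 1), by positivity, by positivity, ?_⟩
  intro G hG hGs hTP k ν u hk hu hν x hx
  set P := ritzProj a G with hP
  have hPG : ∀ w, P w ∈ G := ritzProj_mem ha hG hC' hGs
  have haP : ∀ w v, v ∈ G → a (P w) v = a w v := fun w v hv => apply_ritzProj ha hG hC' hGs w hv
  have hPT : ∀ j, P (T (u j)) = ν j • u j := fun j =>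
    (eq_ritzProj ha hG hC' hGs (G.smul_mem _ (hu.eigenpair j).1) fun v hv => by
      rw [haT, map_smul]; exact (hu.eigenpair j).2.2 v hv).symm
  have hTΦ : ∀ w, Φ (S w) = T w := fun w => DFunLike.congr_fun hΦS w
  set L := S.comp (P.comp Φ) with hL
  have hLs : L.IsSymmetric := fun y z => by
    change inner ℝ (S (P (Φ y))) z = inner ℝ y (S (P (Φ z)))
    rw [real_inner_comm, ← hΦ, ← hΦ, ← haP _ _ (hPG _), ← haP (Φ y) _ (hPG _), ha]
  have hLc : IsCompactOperator L := hSc.comp_clm _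
  have hKL : ‖S.comp Φ - L‖ ≤ η := by
    refine ContinuousLinearMap.opNorm_le_bound _ hη0.le fun y => ?_
    set X := S.comp Φ - L with hX
    -- By symmetry `‖X y‖²` is controlled by `X²`, in which the small factor `T - P T` appears; `X`
    -- itself does not contain it.
    have hXs : inner ℝ (X (X y)) y = inner ℝ (X y) (X y) := (hK.sub hLs) (X y) y
    have hXX : X (X y) = S ((T - P.comp T) (Φ y - P (Φ y))) := by
      simp [hX, hL, ← hTΦ]
    have h1 : ‖X (X y)‖ ≤ ‖S‖ * (η ^ 2 / (M + 1) * ((1 + p) * (‖Φ‖ * ‖y‖))) := by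
      rw [hXX]
      refine S.le_opNorm_of_le ((ContinuousLinearMap.le_of_opNorm_le _ hTP.le _).trans ?_)
      gcongr
      refine (norm_sub_ritzProj_le ha hG hC' hGs _).trans ?_
      gcongr
      exact Φ.le_opNorm y
    have h2 : ‖S‖ * (η ^ 2 / (M + 1) * ((1 + p) * (‖Φ‖ * ‖y‖))) ≤ η ^ 2 * ‖y‖ := by
      have : M / (M + 1) ≤ 1 := (div_le_one (by positivity)).2 (by linarith)
      calc _ = (M / (M + 1)) * (η ^ 2 * ‖y‖) := by rw [hM]; ring
        _ ≤ 1 * (η ^ 2 * ‖y‖) := by gcongr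
        _ = _ := one_mul _
    rw [← sq_le_sq₀ (norm_nonneg _) (by positivity), ← real_inner_self_eq_norm_sq, ← hXs]
    calc _ ≤ ‖X (X y)‖ * ‖y‖ := real_inner_le_norm _ _
      _ ≤ (η ^ 2 * ‖y‖) * ‖y‖ := by gcongr; exact h1.trans h2
      _ = _ := by ring
  set w : Fin k → E := fun j => S (u j) with hw
  have hLw : ∀ j, L (w j) = ν j • w j := fun j => by
    simp only [hL, hw, ContinuousLinearMap.comp_apply, hTΦ, hPT, map_smul]
  have hwli : LinearIndependent ℝ w := by
    refine Fintype.linearIndependent_iff.2 fun g hg j => ?_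
    have h1 : ∑ j, (g j * ν j) • u j = 0 := by
      have h2 := congrArg (fun y => P (Φ y)) hg
      simpa [hw, hTΦ, hPT, smul_smul] using h2
    exact (mul_eq_zero.1 (Fintype.linearIndependent_iff.1 hu.linearIndependent _ h1 j)).resolve_right
      (hν j)
  have hwo : ∀ i j, i ≠ j → inner ℝ (w i) (w j) = 0 := fun i j hij => by
    rw [hS, ← (hu.eigenpair i).2.2 _ (hu.eigenpair j).1, hu.orthogonal i j hij, mul_zero]
  have hspan : Submodule.span ℝ (Set.range w) =
      (Submodule.span ℝ (Set.range u)).map (S : H →ₗ[ℝ] E) := by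
    rw [Submodule.map_span, ← Set.range_comp]; rfl
  -- Eigenvectors of `L` lift to the discrete problem by `y ↦ P (Φ y)`; `ν' ≠ 0` keeps the lift
  -- nonzero and lets `S` recover `y` from it.
  have hmax : ∀ (ν' : ℝ) (y : E), y ≠ 0 → ν' ≠ 0 → L y = ν' • y →
      y ∉ Submodule.span ℝ (Set.range w) → ∀ j, |ν'| ≤ |ν j| := by
    intro ν' y hy hν' hLy hys
    have hSP : S (P (Φ y)) = ν' • y := hLy
    refine hu.largest ν' (P (Φ y)) ⟨hPG _, fun h0 => ?_, fun v hv => ?_⟩ fun hm => hys ?_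
    · rw [h0, map_zero] at hSP
      exact smul_ne_zero hν' hy hSP.symm
    · rw [← hS, hSP, haP _ v hv, hΦ, real_inner_smul_left]
    · rw [hspan]
      refine ⟨ν'⁻¹ • P (Φ y), Submodule.smul_mem _ _ hm, ?_⟩
      rw [ContinuousLinearMap.coe_coe, map_smul, hSP, inv_smul_smul₀ hν']
  set W := Submodule.span ℝ (Set.range w) with hW
  have : FiniteDimensional ℝ W := FiniteDimensional.span_of_finite ℝ (Set.finite_range w)
  set r := P (T x) - μ • x with hr
  obtain ⟨q, hq, hqx⟩ : ∃ q ∈ Submodule.span ℝ (Set.range u), S q = W.starProjection (S x) := by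
    exact hspan.le (W.starProjection_apply_mem (S x))
  set y := S x - S q with hy
  have hyW : y ∈ Wᗮ := by
    rw [hy, hqx]
    exact W.sub_starProjection_mem_orthogonal _
  have hinv := fun z => apply_mem_span_of_eigenvectors (L := (L : E →ₗ[ℝ] E)) (x := z) hLw
  have hy1 : η * ‖y‖ ≤ ‖L y - μ • y‖ :=
    le_norm_apply_sub_smul_of_mem_orthogonal_span hρF hρ hη0.le (by rw [hη]; linarith) hKL hLs hLc
      (hdim.trans hk) hLw hwli hwo hmax hyW
  -- As `S r = (L - μ) S x` and `L` preserves both `W` and `Wᗮ`, the left side is the norm of the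
  -- `Wᗮ`-component of `S r`.
  have hy2 : ‖L y - μ • y‖ ≤ ‖S r‖ := by
    have h1 : L y - μ • y ∈ Wᗮ :=
      Submodule.sub_mem _ (apply_mem_orthogonal hLs hinv hyW) (Submodule.smul_mem _ _ hyW)
    have h2 : L (S q) - μ • S q ∈ W := by
      have hSq : S q ∈ W := by rw [hqx]; exact W.starProjection_apply_mem _
      exact Submodule.sub_mem _ (hinv _ hSq) (Submodule.smul_mem _ _ hSq)
    have h3 : S r = (L (S q) - μ • S q) + (L y - μ • y) := by
      simp only [hr, hy, hL, ContinuousLinearMap.comp_apply, map_sub, map_smul, hTΦ, smul_sub]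
      abel
    have h4 := norm_add_sq_eq_norm_sq_add_norm_sq_of_inner_eq_zero _ _
      ((Submodule.mem_orthogonal _ _).1 h1 _ h2)
    rw [← h3] at h4
    nlinarith [norm_nonneg (S r), norm_nonneg (L y - μ • y), mul_self_nonneg ‖L (S q) - μ • S q‖]
  have hy3 : ‖y‖ ≤ ‖S‖ / η * ‖r‖ := by
    rw [div_mul_eq_mul_div, le_div_iff₀ hη0, mul_comm]
    exact (hy1.trans hy2).trans (S.le_opNorm r)
  -- Only `S (x - q)` is under control, so `q` itself need not be close to `x` in `H`. Applying `P
  -- Φ` turns the `E`-bound into an `H`-bound, through `μ x = P T x - r`.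
  refine ⟨μ⁻¹ • P (T q), Submodule.smul_mem _ _
    (apply_mem_span_of_eigenvectors (L := ((P.comp T : H →L[ℝ] H) : H →ₗ[ℝ] H)) hPT hq), ?_⟩
  have hxq : x - μ⁻¹ • P (T q) = μ⁻¹ • (P (Φ y) - r) := by
    rw [hy, map_sub, map_sub, hTΦ, hTΦ, hr, smul_sub, smul_sub, smul_sub, inv_smul_smul₀ hμ]
    abel
  rw [hxq, norm_smul, norm_inv, Real.norm_eq_abs, div_mul_eq_mul_div, inv_mul_eq_div]
  gcongr
  calc ‖P (Φ y) - r‖ ≤ ‖P (Φ y)‖ + ‖r‖ := norm_sub_le _ _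
    _ ≤ p * (‖Φ‖ * (‖S‖ / η * ‖r‖)) + ‖r‖ := by
        gcongr
        refine (norm_ritzProj_le ha hG hC' hGs _).trans ?_
        gcongr
        exact Φ.le_opNorm_of_le hy3
    _ = _ := by ring

end DiscreteSpectrum
-- One level of the algorithm and the recursion
section Multilevel

variable {H : Type*} [NormedAddCommGroup H] [InnerProductSpace ℝ H]

namespace IsMultilevelRun

variable {a b : H →L[ℝ] H →L[ℝ] ℝ} {k N : ℕ} {G Gt : ℕ → Submodule ℝ H}
  {ν : ℕ → Fin k → ℝ} {u uh : ℕ → Fin k → H}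

theorem le_aux (h : IsMultilevelRun a b k N G Gt ν u uh) {i : ℕ} (hi : i ≤ N) : G 0 ≤ Gt i := by
  cases i with
  | zero => exact h.start.ge
  | succ i => rw [h.enrich i hi]; exact le_sup_left

theorem isClosed_aux (h : IsMultilevelRun a b k N G Gt ν u uh) {i : ℕ} (hi : i ≤ N) :
    IsClosed (Gt i : Set H) := by
  cases i with
  | zero => rw [h.start]; exact h.closed 0 hi
  | succ i =>
    rw [h.enrich i hi]
    have := FiniteDimensional.span_of_finite ℝ (Set.finite_range (uh (i + 1)))
    exact Submodule.isClosed_sup_finiteDimensional _ _ (h.closed 0 (Nat.zero_le N))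

end IsMultilevelRun

theorem le_sum_of_le_add_mul {d δ : ℕ → ℝ} {β t : ℝ} (ht : 0 ≤ t) (N : ℕ) (h0 : d 0 ≤ β * δ 0)
    (hs : ∀ i < N, d (i + 1) ≤ β * δ (i + 1) + t * d i) :
    d N ≤ β * ∑ l ∈ Finset.range (N + 1), t ^ (N - l) * δ l := by
  induction N with
  | zero => simpa using h0
  | succ n ih =>
    have h1 := ih fun i hi => hs i (hi.trans n.lt_succ_self)
    have h2 : ∑ l ∈ Finset.range (n + 1), t ^ (n + 1 - l) * δ l =
        t * ∑ l ∈ Finset.range (n + 1), t ^ (n - l) * δ l := by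
      rw [Finset.mul_sum]
      refine Finset.sum_congr rfl fun l hl => ?_
      rw [Nat.succ_sub (Nat.lt_succ_iff.1 (Finset.mem_range.1 hl)), pow_succ]
      ring
    rw [Finset.sum_range_succ, h2, Nat.sub_self, pow_zero, one_mul]
    have h3 := mul_le_mul_of_nonneg_left h1 ht
    linarith [hs n n.lt_succ_self]

variable [CompleteSpace H]

/-- With `P`, `P'` the projections onto `G`, `G'`, one has `T - P' T = (1 - P') (T - P T)`, as `P'`
fixes `G`. Hence largeness of `G 0` passes to every stable auxiliary space. -/
theorem norm_sub_ritzProj_comp_le {a : H →L[ℝ] H →L[ℝ] ℝ} (ha : ∀ v w, a v w = a w v)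
    {G G' : Submodule ℝ H} (hG : IsClosed (G : Set H)) (hG' : IsClosed (G' : Set H)) {C : ℝ}
    (hC : 0 < C) (h : InfSup a G C) (h' : InfSup a G' C) (hle : G ≤ G') (T : H →L[ℝ] H) :
    ‖T - (ritzProj a G').comp T‖ ≤ (1 + ‖a‖ / C) * ‖T - (ritzProj a G).comp T‖ := by
  refine ContinuousLinearMap.opNorm_le_bound _ (by positivity) fun w => ?_
  have h1 : (T - (ritzProj a G').comp T) w = (T - (ritzProj a G).comp T) w -
      ritzProj a G' ((T - (ritzProj a G).comp T) w) := by
    simp [ritzProj_of_mem ha hG' hC h' (hle (ritzProj_mem ha hG hC h (T w)))]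
  rw [h1, mul_assoc]
  refine (norm_sub_ritzProj_le ha hG' hC h' _).trans ?_
  gcongr
  exact ContinuousLinearMap.le_opNorm _ _

/-- One step of the algorithm: from the auxiliary space `Gt` to `G₀ + span uh`. -/
theorem gap_le_of_source {a b : H →L[ℝ] H →L[ℝ] ℝ} (ha : ∀ v w, a v w = a w v)
    {C : ℝ} (hC : 0 < C) (hInf : InfSup a ⊤ C) {μ : ℝ} (hμ : μ ≠ 0) {C' : ℝ} (hC' : 0 < C')
    {G₀ Gt G Gn : Submodule ℝ H} (hG₀ : IsClosed (G₀ : Set H)) (hGt : IsClosed (Gt : Set H))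
    (hG : IsClosed (G : Set H)) (hs₀ : InfSup a G₀ C') (hst : InfSup a Gt C') (hs : InfSup a G C')
    (hle : G₀ ≤ Gt) {k : ℕ} {ν : Fin k → ℝ} {u uh : Fin k → H} (hν : ∀ j, ν j ≠ 0)
    (hsource : ∀ j, uh j ∈ G ∧ ∀ v ∈ G, a (uh j) v = 1 / ν j * b (u j) v)
    (hGn : Submodule.span ℝ (Set.range uh) ≤ Gn) {c : ℝ} (hc : 0 ≤ c)
    (hres : ∀ x ∈ Gt, ∃ q ∈ Submodule.span ℝ (Set.range u),
      ‖x - q‖ ≤ c * ‖ritzProj a Gt (solutionOp a b x) - μ • x‖) :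
    gap (Module.End.eigenspace (solutionOp a b : H →ₗ[ℝ] H) μ) Gn ≤
      (1 + ‖a‖ / C') * gap (Module.End.eigenspace (solutionOp a b : H →ₗ[ℝ] H) μ) G +
      ‖a‖ / C' * (1 + ‖solutionOp a b‖ * (c * (‖a‖ / C'))) * (1 + ‖a‖ / C') / |μ| *
        ‖solutionOp a b - (solutionOp a b).comp (ritzProj a G₀)‖ *
        gap (Module.End.eigenspace (solutionOp a b : H →ₗ[ℝ] H) μ) Gt := by
  set T := solutionOp a b with hTdef
  set p := ‖a‖ / C' with hp
  have hp0 : 0 ≤ p := by positivity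
  set τ := ‖T - T.comp (ritzProj a G₀)‖ with hτ
  set M := Module.End.eigenspace (T : H →ₗ[ℝ] H) μ with hM
  have hμ0 : 0 < |μ| := abs_pos.2 hμ
  have hg1 := gap_nonneg M G
  have hg2 := gap_nonneg M Gt
  refine gap_le (by positivity) fun w hw hw1 => ?_
  have hTw : T w = μ • w := Module.End.mem_eigenspace_iff.1 hw
  set e := w - ritzProj a Gt w with he
  have he1 : ‖e‖ ≤ (1 + p) * gap M Gt :=
    (norm_sub_ritzProj_le_infDist ha hGt hC' hst w).trans (by
      gcongr; exact infDist_le_gap hw hw1)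
  have hTe : ‖T e‖ ≤ τ * ((1 + p) * gap M Gt) := by
    have h1 : T e = (T - T.comp (ritzProj a G₀)) e := by
      -- Here `G₀ ≤ Gt` enters: the error `e` is `a`-orthogonal to `G₀`, which produces the factor
      -- `τ`.
      have h2 : ritzProj a G₀ e = 0 := by
        rw [he, map_sub, ritzProj_ritzProj_of_le ha hG₀ hC' hs₀ hGt hC' hst hle, sub_self]
      simp [h2]
    rw [h1]
    exact ContinuousLinearMap.le_opNorm_of_le _ he1
  obtain ⟨q, hq, hqx⟩ := hres _ (ritzProj_mem ha hGt hC' hst w)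
  have hr : ritzProj a Gt (T (ritzProj a Gt w)) - μ • ritzProj a Gt w = -ritzProj a Gt (T e) := by
    rw [he, map_sub, map_sub, hTw, map_smul, neg_sub]
  rw [hr, norm_neg] at hqx
  have hq1 : ‖ritzProj a Gt w - q‖ ≤ c * (p * ‖T e‖) :=
    hqx.trans (by gcongr; exact norm_ritzProj_le ha hGt hC' hst _)
  have hTq : ‖T w - T q‖ ≤ (1 + ‖T‖ * (c * p)) * ‖T e‖ := by
    have h1 : T w - T q = T e + T (ritzProj a Gt w - q) := by
      rw [← map_sub, ← map_add, he, sub_add_sub_cancel]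
    rw [h1]
    refine (norm_add_le _ _).trans ?_
    linarith [T.le_opNorm_of_le hq1]
  have huh : ∀ j, ritzProj a G (T (u j)) = ν j • uh j := fun j =>
    (eq_ritzProj ha hG hC' hs (G.smul_mem _ (hsource j).1) fun v hv => by
      rw [map_smul, smul_apply, (hsource j).2 v hv,
        apply_solutionOp ha hC hInf, smul_eq_mul, ← mul_assoc, mul_one_div_cancel (hν j),
        one_mul]).symm
  -- The source problems say that `P_G T` maps `u j` to `ν j • uh j`, hence `span u` into `span uh`.
  have hmem : μ⁻¹ • ritzProj a G (T q) ∈ Gn := by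
    refine Gn.smul_mem _ (hGn ?_)
    have hle : Submodule.span ℝ (Set.range u) ≤ (Submodule.span ℝ (Set.range uh)).comap
        (((ritzProj a G).comp T : H →L[ℝ] H) : H →ₗ[ℝ] H) := by
      refine Submodule.span_le.2 ?_
      rintro _ ⟨j, rfl⟩
      change ritzProj a G (T (u j)) ∈ Submodule.span ℝ (Set.range uh)
      rw [huh]
      exact Submodule.smul_mem _ _ (Submodule.subset_span ⟨j, rfl⟩)
    exact hle hq
  refine (Metric.infDist_le_dist_of_mem hmem).trans ?_
  have hdec : w - μ⁻¹ • ritzProj a G (T q) =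
      (w - ritzProj a G w) + μ⁻¹ • ritzProj a G (T w - T q) := by
    rw [hTw, map_sub, map_smul, smul_sub, inv_smul_smul₀ hμ]
    abel
  rw [dist_eq_norm, hdec]
  refine (norm_add_le _ _).trans (add_le_add ?_ ?_)
  · exact (norm_sub_ritzProj_le_infDist ha hG hC' hs w).trans (by
      gcongr; exact infDist_le_gap hw hw1)
  · rw [norm_smul, norm_inv, Real.norm_eq_abs]
    calc |μ|⁻¹ * ‖ritzProj a G (T w - T q)‖
        ≤ |μ|⁻¹ * (p * ((1 + ‖T‖ * (c * p)) * (τ * ((1 + p) * gap M Gt)))) := by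
          gcongr
          refine (norm_ritzProj_le ha hG hC' hs _).trans ?_
          gcongr
          exact hTq.trans (by gcongr)
      _ = _ := by ring

end Multilevel
end MultilevelEigen

/-! ### The multilevel estimate -/

open MultilevelEigen in
theorem mainTheorem6 {H : Type*} [NormedAddCommGroup H] [InnerProductSpace ℝ H] [CompleteSpace H]
    (a b : H →L[ℝ] H →L[ℝ] ℝ)
    (ha : ∀ v w, a v w = a w v) (hb : ∀ v w, b v w = b w v) (hb0 : ∀ v, 0 ≤ b v v)
    (C : ℝ) (hC : 0 < C) (hHIS : MultilevelEigen.InfSup a ⊤ C)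
    (hT : IsCompactOperator (MultilevelEigen.solutionOp a b))
    (μ : ℝ) (hμ : μ ≠ 0)
    (hμT : Module.End.HasEigenvalue (MultilevelEigen.solutionOp a b : H →ₗ[ℝ] H) μ)
    (C' : ℝ) (hC' : 0 < C') :
    ∃ β₁ β₂ ε : ℝ, 0 < β₁ ∧ 0 < β₂ ∧ 0 < ε ∧
      ∀ (k N : ℕ) (G Gt : ℕ → Submodule ℝ H)
        (ν : ℕ → Fin k → ℝ) (u uh : ℕ → Fin k → H),
        -- the eigenvalues of modulus at least `|μ|`, with multiplicity, are among the first `k`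
        Module.finrank ℝ ↥(⨆ ν' : {ν' : ℝ // |μ| ≤ |ν'|},
          Module.End.eigenspace (MultilevelEigen.solutionOp a b : H →ₗ[ℝ] H) ν'.1) ≤ k →
        MultilevelEigen.IsMultilevelRun a b k N G Gt ν u uh →
        -- uniform stability of the discrete spaces
        (∀ i ≤ N, MultilevelEigen.InfSup a (G i) C') →
        (∀ i < N, MultilevelEigen.InfSup a (Gt i) C') →
        -- `G 0` is large enough
        ‖MultilevelEigen.solutionOp a b
          - (MultilevelEigen.ritzProj a (G 0)).comp (MultilevelEigen.solutionOp a b)‖ < ε →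
        MultilevelEigen.gap
            (Module.End.eigenspace (MultilevelEigen.solutionOp a b : H →ₗ[ℝ] H) μ) (Gt N) ≤
          β₁ * ∑ l ∈ Finset.range (N + 1),
            (β₂ * ‖MultilevelEigen.solutionOp a b
              - (MultilevelEigen.solutionOp a b).comp
                  (MultilevelEigen.ritzProj a (G 0))‖) ^ (N - l)
            * MultilevelEigen.gap
                (Module.End.eigenspace (MultilevelEigen.solutionOp a b : H →ₗ[ℝ] H) μ) (G l) := by

  obtain ⟨c, ε, hc, hε, hmain⟩ := exists_norm_sub_le_residual a b ha hb hb0 hC hHIS hT hμ hC'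
  have hμ0 : 0 < |μ| := abs_pos.2 hμ
  -- The constants are those of `gap_le_of_source`; the added 1 makes `β₂` positive even if `‖a‖`
  -- vanishes. The threshold is divided by the loss in passing from `G 0` to the auxiliary spaces.
  refine ⟨1 + ‖a‖ / C', ‖a‖ / C' * (1 + ‖solutionOp a b‖ * (c * (‖a‖ / C'))) *
    (1 + ‖a‖ / C') / |μ| + 1, ε / (1 + ‖a‖ / C'), by positivity, by positivity, by positivity, ?_⟩
  intro k N G Gt ν u uh hk hrun hsG hsGt hε'
  rw [lt_div_iff₀' (by positivity)] at hε'
  refine le_sum_of_le_add_mul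
    (d := fun i => gap (Module.End.eigenspace (solutionOp a b : H →ₗ[ℝ] H) μ) (Gt i))
    (δ := fun i => gap (Module.End.eigenspace (solutionOp a b : H →ₗ[ℝ] H) μ) (G i))
    (by positivity) N ?_ fun i hi => ?_
  · rw [hrun.start]
    exact le_mul_of_one_le_left (gap_nonneg _ _) (le_add_of_nonneg_right (by positivity))
  · have hcl := hrun.isClosed_aux hi.le
    have hcl0 := hrun.closed 0 (Nat.zero_le N)
    have hs0 := hsG 0 (Nat.zero_le N)
    have hT' := norm_sub_ritzProj_comp_le ha hcl0 hcl hC' hs0 (hsGt i hi) (hrun.le_aux hi.le)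
      (solutionOp a b)
    have hstep := gap_le_of_source ha hC hHIS hμ hC' hcl0 hcl (hrun.closed (i + 1) hi) hs0
      (hsGt i hi) (hsG (i + 1) hi) (hrun.le_aux hi.le) (hrun.ne_zero i hi) (hrun.source i hi)
      (Gn := Gt (i + 1)) (by rw [hrun.enrich i hi]; exact le_sup_right) hc.le
      (hmain (Gt i) hcl (hsGt i hi) (hT'.trans_lt hε') k (ν i) (u i) hk (hrun.eigen i hi.le)
        (hrun.ne_zero i hi))
    refine hstep.trans ?_
    gcongr
    · exact gap_nonneg _ _
    · linarith
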